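/- Let $\mathbb K=\mathbb R$ or $\mathbb C$ and let $\mathfrak g$ be a finite-dimensional nilpotent Lie algebra over $\mathbb K$. For $\alpha\in\mathfrak g^*$ put $d\alpha(X,Y)=-\alpha([X,Y])$, and call $\alpha$ closed if $d\alpha=0$. Let $\mathcal O(\alpha)$ be the coadjoint orbit of $\alpha$; its dimension over $\mathbb K$ is the dimension of its tangent space at $\alpha$, which is spanned by the velocities at $t=0$ of the curves $t\mapsto \mathrm{Ad}^*(\exp tX)\alpha$, $X\in\mathfrak g$. For $X\in\mathfrak g$ let $c(X)$ be the non-increasing sequence of the dimensions of the Jordan blocks of the nilpotent operator $\operatorname{ad}X$ on $\mathfrak g$; the characteristic sequence of $\mathfrak g$ is $c(\mathfrak g)=\max\{c(X): X\in\mathfrak g\setminus[\mathfrak g,\mathfrak g]\}$ for the lexicographic order, and $X\in\mathfrak g$ is called a characteristic vector of $\mathfrak g$ if $c(X)=c(\mathfrak g)$. Theorem. Suppose that $\dim\mathcal O(\alpha)=4$ for every nonclosed $\alpha\in\mathfrak g^*$, and that $\mathfrak g=\mathfrak m\oplus I$ as vector spaces, where $I$ is an abelian ideal of codimension $2$ and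 $\mathfrak m$ is a linear subspace. Then $\mathfrak m$ has a basis $\{T_1,T_2\}$ consisting of characteristic vectors of $\mathfrak g$ with the same characteristic sequence, $c(T_1)=c(T_2)=c(\mathfrak g)$, and such that $\operatorname{Im}(\operatorname{ad}T_1)=\operatorname{Im}(\operatorname{ad}T_2)$. -/

import Mathlib

namespace Coadjoint

section Definitions

variable {𝕜 : Type*} [RCLike 𝕜] {g : Type*} [LieRing g] [LieAlgebra 𝕜 g]

/-- The differential `dα` of a linear form, viewed as a left invariant Pfaffian form:
`dα(X, Y) = -α([X, Y])`. -/
def d (α : Module.Dual 𝕜 g) : g →ₗ[𝕜] g →ₗ[𝕜] 𝕜 :=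
  -((LieModule.toEnd 𝕜 g g : g →ₗ[𝕜] Module.End 𝕜 g).compr₂ α)

/-- A linear form is closed when its differential vanishes. -/
def IsClosedForm (α : Module.Dual 𝕜 g) : Prop := d α = 0

/-- The coadjoint action of the group element `exp X` on the linear form `α`, evaluated at `Y`:
`⟨Ad*(exp X) α, Y⟩ = ⟨α, Ad(exp (-X)) Y⟩ = ⟨α, exp(ad (-X)) Y⟩`, the exponential of the
endomorphism `ad (-X)` being given by its power series (the series of scalars below converges
absolutely when `g` is finite-dimensional, and is a finite sum when `g` is nilpotent). -/
noncomputable def coadExp (X : g) (α : Module.Dual 𝕜 g) (Y : g) : 𝕜 :=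
  ∑' k : ℕ, (k.factorial : 𝕜)⁻¹ * α (((LieAlgebra.ad 𝕜 g (-X)) ^ k) Y)

/-- The tangent space at `α` to the coadjoint orbit of `α`: the image of the differential at the
identity of the orbit map `x ↦ Ad*(x) α`. It consists of the velocities at `t = 0` of the curves
`t ↦ Ad*(exp (t X)) α` for `X` in `g` (the derivative in the dual space is taken pointwise). -/
def orbitTangentSpace (α : Module.Dual 𝕜 g) : Submodule 𝕜 (Module.Dual 𝕜 g) :=
  Submodule.span 𝕜 {β | ∃ X : g, ∀ Y : g,
    HasDerivAt (fun t : 𝕜 => coadExp (t • X) α Y) (β Y) 0}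

/-- The dimension over `𝕜` of the coadjoint orbit of `α`. The orbit is a homogeneous manifold, so
its dimension is that of its tangent space at `α`. -/
noncomputable def orbitDim (α : Module.Dual 𝕜 g) : ℕ :=
  Module.finrank 𝕜 (orbitTangentSpace α)

/-- `c` is the non-increasing sequence of the dimensions of the Jordan blocks of the nilpotent
endomorphism `N`: there is a Jordan basis `e i j`, where `j` is less than `c i`, with
`N (e i j) = e i (j + 1)` inside a block and `N (e i j) = 0` at the end of a block. -/
def IsJordanSequence {V : Type*} [AddCommGroup V] [Module 𝕜 V] (N : Module.End 𝕜 V)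
    (c : List ℕ) : Prop :=
  c.Pairwise (fun a b => b ≤ a) ∧ (∀ a ∈ c, 0 < a) ∧
    ∃ e : Module.Basis (Σ i : Fin c.length, Fin (c.get i)) 𝕜 V,
      ∀ (i : Fin c.length) (j : Fin (c.get i)),
        N (e ⟨i, j⟩) = if h : (j : ℕ) + 1 < c.get i then e ⟨i, ⟨j + 1, h⟩⟩ else 0

variable (𝕜 g) in
/-- `c` is the characteristic sequence of `g`: the maximum, for the lexicographic order, of the
Jordan sequences `c(X)` of `ad X` for `X` outside the derived algebra `[g, g]`. -/
def IsCharacteristicSequence (c : List ℕ) : Prop :=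
  IsGreatest {s : List ℕ | ∃ X : g, X ∉ ⁅(⊤ : LieIdeal 𝕜 g), (⊤ : LieIdeal 𝕜 g)⁆ ∧
    IsJordanSequence (LieAlgebra.ad 𝕜 g X) s} c

variable (𝕜) in
/-- `X` is a characteristic vector of `g`: the Jordan sequence `c(X)` is that of `g`. -/
def IsCharacteristicVector (X : g) : Prop :=
  ∃ c : List ℕ, IsCharacteristicSequence 𝕜 g c ∧ IsJordanSequence (LieAlgebra.ad 𝕜 g X) c

end Definitions

end Coadjoint

/-! The tangent space to the orbit of α is the image of dα, so dα has rank 4 unless α is closed. Let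
T lie outside I. If α vanishes on [T, I], then I + 𝕜T is a hyperplane isotropic for dα, which forces
rank at most 2; hence α is closed. By duality [g, g] ⊆ [T, I] (`lie_mem_map_ad`), so [T, I] = Im(ad
T) = [g, g] for every T outside I. In particular [g, g] ⊆ I, so any two such ad S, ad T commute on I
and have the same image there. All their powers then have equal images, and ranks of powers
determine Jordan sequences. For X in I, (ad X)² = 0 and rank ad X ≤ dim [g, g] = rank ad T, so c(X)
≤ c(T). Any basis of the complement of I therefore works. -/

namespace Coadjoint

/-! ### Block sequences and ranks of powers -/

section Lists

/-- Rank of the `k`-th power of a nilpotent endomorphism with Jordan blocks of sizes `c`. -/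
def powRank (c : List ℕ) (k : ℕ) : ℕ := (c.map (· - k)).sum

@[simp] theorem powRank_nil (k : ℕ) : powRank [] k = 0 := rfl

@[simp] theorem powRank_cons (a : ℕ) (c : List ℕ) (k : ℕ) :
    powRank (a :: c) k = (a - k) + powRank c k := by
  simp [powRank]

theorem powRank_eq_zero_iff {c : List ℕ} {k : ℕ} : powRank c k = 0 ↔ ∀ a ∈ c, a ≤ k := by
  simp [powRank, List.sum_eq_zero_iff, Nat.sub_eq_zero_iff_le]

theorem powRank_pos_of_mem {c : List ℕ} {k a : ℕ} (ha : a ∈ c) (hk : k < a) :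
    0 < powRank c k := by
  by_contra! h
  exact absurd (powRank_eq_zero_iff.mp (Nat.le_zero.mp h) a ha) (by omega)

/-- A non-increasing sequence of positive integers is determined by `powRank`. -/
theorem eq_of_powRank_eq {c s : List ℕ} (hc : c.Pairwise (fun a b => b ≤ a))
    (hs : s.Pairwise (fun a b => b ≤ a)) (hc0 : ∀ a ∈ c, 0 < a) (hs0 : ∀ a ∈ s, 0 < a)
    (h : ∀ k, powRank c k = powRank s k) : c = s := by
  induction c generalizing s with
  | nil =>
    cases s with
    | nil => rfl
    | cons b s =>
      have := powRank_pos_of_mem (c := b :: s) (List.mem_cons_self) (hs0 b List.mem_cons_self)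
      simp [← h] at this
  | cons a c ih =>
    cases s with
    | nil =>
      have := powRank_pos_of_mem (c := a :: c) (List.mem_cons_self) (hc0 a List.mem_cons_self)
      simp [h] at this
    | cons b s =>
      -- The head is the largest entry, i.e. the least k with `powRank` zero.
      have hle : ∀ {a b : ℕ} {c s : List ℕ}, (a :: c).Pairwise (fun a b => b ≤ a) →
          powRank (a :: c) a = powRank (b :: s) a → b ≤ a := by
        intro a b c s hc h
        have h0 : powRank (a :: c) a = 0 := powRank_eq_zero_iff.mpr fun x hx => by
          rcases List.mem_cons.mp hx with rfl | hx
          · exact le_rfl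
          · exact List.rel_of_pairwise_cons hc hx
        exact powRank_eq_zero_iff.mp (h ▸ h0) b List.mem_cons_self
      have hab : a = b := le_antisymm (hle hs (h b).symm) (hle hc (h a))
      subst hab
      rw [ih hc.of_cons hs.of_cons (fun x hx => hc0 x (List.mem_cons_of_mem _ hx))
        (fun x hx => hs0 x (List.mem_cons_of_mem _ hx)) fun k => by simpa using h k]

/-- Among the block sequences of a fixed total size, one with blocks of size at most two is
lexicographically below every one of at least the same rank. -/
theorem le_of_powRank_one_le {c s : List ℕ} (hc : c.Pairwise (fun a b => b ≤ a))
    (hc0 : ∀ a ∈ c, 0 < a) (hs0 : ∀ a ∈ s, 0 < a) (hs2 : ∀ a ∈ s, a ≤ 2)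
    (hsum : powRank s 0 = powRank c 0) (hle : powRank s 1 ≤ powRank c 1) : s ≤ c := by
  rw [← not_lt]
  induction c generalizing s with
  | nil =>
    cases s with
    | nil => simp
    | cons b s =>
      have := hs0 b List.mem_cons_self
      simp at hsum
      omega
  | cons a c ih =>
    cases s with
    | nil => simp
    | cons b s =>
      have hb := hs2 b List.mem_cons_self
      have ha := hc0 a List.mem_cons_self
      rw [List.cons_lt_cons_iff]
      rintro (hab | ⟨rfl, hlt⟩)
      -- Here a = 1 and b = 2, so all blocks of c have size 1 and its rank is 0, while s has
      -- positive rank.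
      · have h0 : powRank (a :: c) 1 = 0 := powRank_eq_zero_iff.mpr fun x hx => by
          rcases List.mem_cons.mp hx with rfl | hx
          · omega
          · have := List.rel_of_pairwise_cons hc hx
            omega
        rw [h0] at hle
        have := powRank_eq_zero_iff.mp (Nat.le_zero.mp hle) b List.mem_cons_self
        omega
      · refine ih hc.of_cons (fun x hx => hc0 x (List.mem_cons_of_mem _ hx))
          (fun x hx => hs0 x (List.mem_cons_of_mem _ hx))
          (fun x hx => hs2 x (List.mem_cons_of_mem _ hx)) ?_ ?_ hlt
        · simpa using hsum
        · simpa using hle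

end Lists

/-! ### Ranks of powers from a Jordan basis -/

section Jordan

variable {K : Type*} [Field K]

theorem finrank_range_pow_of_basis {V : Type*} [AddCommGroup V] [Module K V]
    (N : Module.End K V) {n : ℕ} (f : Fin n → ℕ) (e : Module.Basis (Σ i, Fin (f i)) K V)
    (he : ∀ (i : Fin n) (j : Fin (f i)),
      N (e ⟨i, j⟩) = if h : (j : ℕ) + 1 < f i then e ⟨i, ⟨j + 1, h⟩⟩ else 0) (k : ℕ) :
    Module.finrank K (LinearMap.range (N ^ k)) = ∑ i, (f i - k) := by
  have hk : ∀ (i : Fin n) (j : Fin (f i)),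
      (N ^ k) (e ⟨i, j⟩) = if h : (j : ℕ) + k < f i then e ⟨i, ⟨j + k, h⟩⟩ else 0 := by
    intro i j
    induction k with
    | zero => simp
    | succ k ih =>
      rw [pow_succ', Module.End.mul_apply, ih]
      by_cases h : (j : ℕ) + k < f i
      · simp only [h, dif_pos, he, add_assoc]
      · have h' : ¬ (j : ℕ) + (k + 1) < f i := by omega
        simp [h, h']
  let b : (Σ i, Fin (f i - k)) → V := fun p => e ⟨p.1, ⟨p.2 + k, by have := p.2.2; omega⟩⟩
  have hb : LinearIndependent K b := by
    refine e.linearIndependent.comp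
      (fun p : (Σ i, Fin (f i - k)) => (⟨p.1, ⟨p.2 + k, by have := p.2.2; omega⟩⟩ :
        (Σ i, Fin (f i)))) ?_
    rintro ⟨i, j⟩ ⟨i', j'⟩ h
    obtain rfl : i = i' := congrArg Sigma.fst h
    simpa [Fin.ext_iff] using h
  have hr : LinearMap.range (N ^ k) = Submodule.span K (Set.range b) := by
    rw [LinearMap.range_eq_map, ← e.span_eq, Submodule.map_span]
    apply le_antisymm
    · rw [Submodule.span_le]
      rintro _ ⟨_, ⟨⟨i, j⟩, rfl⟩, rfl⟩
      rw [hk]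
      split_ifs with h
      · exact Submodule.subset_span ⟨⟨i, ⟨j, by omega⟩⟩, rfl⟩
      · exact Submodule.zero_mem _
    · rw [Submodule.span_le]
      rintro _ ⟨⟨i, j⟩, rfl⟩
      refine Submodule.subset_span ⟨e ⟨i, ⟨j, by have := j.2; omega⟩⟩, ⟨_, rfl⟩, ?_⟩
      rw [hk, dif_pos (by have := j.2; simp only; omega)]
  rw [hr, finrank_span_eq_card hb]
  simp

end Jordan

section JordanRCLike

variable {𝕜 : Type*} [RCLike 𝕜]

theorem IsJordanSequence.finrank_range_pow {V : Type*} [AddCommGroup V] [Module 𝕜 V]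
    {N : Module.End 𝕜 V} {c : List ℕ} (h : IsJordanSequence N c) (k : ℕ) :
    Module.finrank 𝕜 (LinearMap.range (N ^ k)) = powRank c k := by
  obtain ⟨-, -, e, he⟩ := h
  rw [finrank_range_pow_of_basis N c.get e he k, powRank, ← List.sum_ofFn]
  congr 1
  conv_rhs => rw [← List.ofFn_get c, List.map_ofFn]
  rfl

end JordanRCLike

/-! ### Existence of Jordan bases -/

section Existence

variable {K : Type*} [Field K] {V : Type*} [AddCommGroup V] [Module K V]

/-- The span of a cyclic block of maximal length of a nilpotent endomorphism has an invariant
complement. -/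
theorem exists_invariant_complement_of_cyclic (N : Module.End K V) {k : ℕ}
    (hk : N ^ k = 0) {v : V} (hv : (N ^ (k - 1)) v ≠ 0) :
    ∃ U : Submodule K V, (∀ u ∈ U, N u ∈ U) ∧
      LinearIndependent K (fun i : Fin k => (N ^ (i : ℕ)) v) ∧
      IsCompl (Submodule.span K (Set.range fun i : Fin k => (N ^ (i : ℕ)) v)) U := by
  obtain ⟨φ, hφ⟩ : ∃ φ : Module.Dual K V, φ ((N ^ (k - 1)) v) ≠ 0 := by
    by_contra! h
    exact hv ((Module.forall_dual_apply_eq_zero_iff K _).mp h)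
  have hge : ∀ {m : ℕ}, k ≤ m → ∀ x, (N ^ m) x = 0 := fun {m} hm x => by
    rw [pow_eq_zero_of_le hm hk, LinearMap.zero_apply]
  -- The matrix of Φ ∘ Ψ is φ(N^(i+j) v): zero for i + j ≥ k, nonzero on the antidiagonal i + j = k
  -- - 1, hence invertible. So ker Φ is a complement of the cyclic block.
  let Φ : V →ₗ[K] (Fin k → K) := LinearMap.pi fun j => φ ∘ₗ (N ^ (j : ℕ))
  let Ψ : (Fin k → K) →ₗ[K] V := Fintype.linearCombination K (fun i : Fin k => (N ^ (i : ℕ)) v)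
  have hinj : ∀ a, Φ (Ψ a) = 0 → a = 0 := by
    intro a ha
    funext i
    obtain ⟨i, hi⟩ := i
    induction i using Nat.strong_induction_on with
    | _ i ih =>
      have h1 := congrFun ha ⟨k - 1 - i, by omega⟩
      have h2 : (N ^ (k - 1 - i)) (Ψ a) = a ⟨i, hi⟩ • (N ^ (k - 1)) v := by
        simp only [Ψ, Fintype.linearCombination_apply, map_sum, map_smul]
        rw [Finset.sum_eq_single ⟨i, hi⟩]
        · rw [← Module.End.mul_apply, ← pow_add]
          congr 3
          simp only
          omega
        · intro j _ hj
          rcases lt_trichotomy (j : ℕ) i with h | h | h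
          · have := ih j h j.2
            rw [Fin.eta] at this
            simp [this]
          · exact absurd (Fin.ext h) hj
          · rw [← Module.End.mul_apply, ← pow_add, hge (by omega), smul_zero]
        · simp
      simp only [Φ, LinearMap.pi_apply, LinearMap.comp_apply, h2, map_smul, smul_eq_mul,
        Pi.zero_apply] at h1
      exact (mul_eq_zero.mp h1).resolve_right hφ
  have hinj' : Function.Injective (Φ ∘ₗ Ψ) := by
    rw [← LinearMap.ker_eq_bot, LinearMap.ker_eq_bot']
    exact hinj
  have hsurj := LinearMap.surjective_of_injective hinj'
  have hrange : Submodule.span K (Set.range fun i : Fin k => (N ^ (i : ℕ)) v)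
      = LinearMap.range Ψ := by
    rw [Fintype.range_linearCombination]
  refine ⟨LinearMap.ker Φ, ?_, ?_, ?_⟩
  · intro u hu
    rw [LinearMap.mem_ker] at hu ⊢
    funext ⟨j, hj⟩
    change φ ((N ^ j) (N u)) = 0
    rw [← Module.End.mul_apply, ← pow_succ]
    by_cases h : j + 1 < k
    · exact congrFun hu ⟨j + 1, h⟩
    · rw [hge (by omega), map_zero]
  · rw [Fintype.linearIndependent_iff]
    intro a ha i
    have h0 : Ψ a = 0 := ha
    rw [hinj a (by rw [h0, map_zero]), Pi.zero_apply]
  · rw [hrange]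
    constructor
    · rw [Submodule.disjoint_def]
      rintro _ ⟨a, rfl⟩ hx
      rw [hinj a hx, map_zero]
    · rw [codisjoint_iff, eq_top_iff]
      rintro x -
      obtain ⟨a, ha⟩ := hsurj (Φ x)
      rw [Submodule.mem_sup]
      refine ⟨Ψ a, ⟨a, rfl⟩, x - Ψ a, ?_, by abel⟩
      rw [LinearMap.mem_ker, map_sub, ← ha, LinearMap.comp_apply, sub_self]

end Existence

section ExistenceRCLike

variable {𝕜 : Type*} [RCLike 𝕜]

theorem IsJordanSequence.cons {V : Type*} [AddCommGroup V] [Module 𝕜 V] {N : Module.End 𝕜 V}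
    {k : ℕ} (hk0 : 0 < k) (hk : N ^ k = 0) {v : V} {U : Submodule 𝕜 V} (hU : ∀ u ∈ U, N u ∈ U)
    (hli : LinearIndependent 𝕜 (fun i : Fin k => (N ^ (i : ℕ)) v))
    (hcompl : IsCompl (Submodule.span 𝕜 (Set.range fun i : Fin k => (N ^ (i : ℕ)) v)) U)
    {c : List ℕ} (hc : IsJordanSequence (N.restrict hU) c) : IsJordanSequence N (k :: c) := by
  -- Since N^k = 0 on U too, no block of U exceeds k, and prepending k keeps the order.
  have hck : ∀ a ∈ c, a ≤ k := by
    rw [← powRank_eq_zero_iff, ← hc.finrank_range_pow, Module.End.pow_restrict,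
      LinearMap.range_eq_bot.mpr, finrank_bot]
    ext x
    simp [hk]
  obtain ⟨hc1, hc2, e, he⟩ := hc
  refine ⟨List.pairwise_cons.mpr ⟨hck, hc1⟩, List.forall_mem_cons.mpr ⟨hk0, hc2⟩, ?_⟩
  let F : (Fin k ⊕ (Σ i : Fin c.length, Fin (c.get i))) →
      (Σ i : Fin (k :: c).length, Fin ((k :: c).get i)) :=
    Sum.elim (fun j => ⟨0, j⟩) (fun p => ⟨p.1.succ, p.2⟩)
  have hF : Function.Bijective F := by
    constructor
    · rintro (j | ⟨i, j⟩) (j' | ⟨i', j'⟩) h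
      · exact congrArg Sum.inl (eq_of_heq (Sigma.mk.inj h).2)
      · exact absurd (congrArg Sigma.fst h) (Fin.succ_ne_zero i').symm
      · exact absurd (congrArg Sigma.fst h) (Fin.succ_ne_zero i)
      · obtain rfl : i = i' := Fin.succ_injective _ (congrArg Sigma.fst h)
        exact congrArg (fun j => Sum.inr (Sigma.mk i j)) (eq_of_heq (Sigma.mk.inj h).2)
    · rintro ⟨i, j⟩
      induction i using Fin.cases with
      | zero => exact ⟨Sum.inl j, rfl⟩
      | succ i => exact ⟨Sum.inr ⟨i, j⟩, rfl⟩
  let b := (((Module.Basis.span hli).prod e).map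
    (Submodule.prodEquivOfIsCompl _ _ hcompl)).reindex (Equiv.ofBijective F hF)
  have hb0 : ∀ j : Fin k, b ⟨0, j⟩ = (N ^ (j : ℕ)) v := by
    intro j
    have : (⟨0, j⟩ : Σ i : Fin (k :: c).length, Fin ((k :: c).get i)) =
      Equiv.ofBijective F hF (Sum.inl j) := rfl
    rw [this]
    simp [b, Module.Basis.span_apply]
  have hb1 : ∀ (i : Fin c.length) (j : Fin (c.get i)), b ⟨i.succ, j⟩ = (e ⟨i, j⟩ : V) := by
    intro i j
    have : (⟨i.succ, j⟩ : Σ i : Fin (k :: c).length, Fin ((k :: c).get i)) =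
      Equiv.ofBijective F hF (Sum.inr ⟨i, j⟩) := rfl
    rw [this]
    simp [b]
  refine ⟨b, fun i j => ?_⟩
  induction i using Fin.cases with
  | zero =>
    change Fin k at j
    change N (b ⟨0, j⟩) = if h : (j : ℕ) + 1 < k then b ⟨0, ⟨j + 1, h⟩⟩ else 0
    rw [hb0, ← Module.End.mul_apply, ← pow_succ']
    split_ifs with h
    · exact (hb0 ⟨j + 1, h⟩).symm
    · rw [pow_eq_zero_of_le (by omega) hk, LinearMap.zero_apply]
  | succ i =>
    change Fin (c.get i) at j
    change N (b ⟨i.succ, j⟩) =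
      if h : (j : ℕ) + 1 < c.get i then b ⟨i.succ, ⟨j + 1, h⟩⟩ else 0
    have := congrArg (Subtype.val) (he i j)
    rw [LinearMap.coe_restrict_apply] at this
    rw [hb1, this]
    split_ifs with h
    · rw [hb1]
    · rfl

theorem exists_isJordanSequence {V : Type*} [AddCommGroup V] [Module 𝕜 V]
    [FiniteDimensional 𝕜 V] {N : Module.End 𝕜 V} (hN : IsNilpotent N) :
    ∃ c, IsJordanSequence N c := by
  induction hn : Module.finrank 𝕜 V using Nat.strong_induction_on generalizing V with
  | _ n ih =>
    rcases subsingleton_or_nontrivial V with hV | hV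
    · refine ⟨[], List.Pairwise.nil, by simp, ?_⟩
      have : IsEmpty (Σ i : Fin ([] : List ℕ).length, Fin (([] : List ℕ).get i)) :=
        ⟨fun p => p.1.elim0⟩
      exact ⟨Module.Basis.empty V, fun i => i.elim0⟩
    · have hk := pow_nilpotencyClass hN
      have hk1 := pow_pred_nilpotencyClass hN
      have hk0 := pos_nilpotencyClass_iff.mpr hN
      obtain ⟨v, hv⟩ : ∃ v, (N ^ (nilpotencyClass N - 1)) v ≠ 0 := by
        by_contra! h
        exact hk1 (LinearMap.ext h)
      obtain ⟨U, hU, hli, hcompl⟩ := exists_invariant_complement_of_cyclic N hk hv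
      have hdim := Submodule.finrank_add_eq_of_isCompl hcompl
      rw [finrank_span_eq_card hli, Fintype.card_fin] at hdim
      have hnil : IsNilpotent (N.restrict hU) := by
        refine ⟨nilpotencyClass N, ?_⟩
        rw [Module.End.pow_restrict]
        ext x
        simp [hk]
      obtain ⟨c, hc⟩ := ih (Module.finrank 𝕜 U) (by omega) hnil rfl
      exact ⟨_, hc.cons hk0 hk hU hli hcompl⟩

end ExistenceRCLike

/-! ### Coadjoint orbits and images of ad -/

section LieAlgebra

variable {𝕜 : Type*} [RCLike 𝕜] {g : Type*} [LieRing g] [LieAlgebra 𝕜 g]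

theorem d_apply (α : Module.Dual 𝕜 g) (X Y : g) : d α X Y = -α ⁅X, Y⁆ := rfl

theorem hasDerivAt_coadExp [LieRing.IsNilpotent g] (α : Module.Dual 𝕜 g) (X Y : g) :
    HasDerivAt (fun t : 𝕜 => coadExp (t • X) α Y) (d α X Y) 0 := by
  obtain ⟨n, hn⟩ := LieModule.isNilpotent_toEnd_of_isNilpotent 𝕜 g g (-X)
  have hn' : ∀ k, n ≤ k → (LieAlgebra.ad 𝕜 g (-X)) ^ k = 0 := fun k hk =>
    pow_eq_zero_of_le hk hn
  -- The bound n + 2 guarantees that the terms k = 0 and k = 1 can be split off; only k = 1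
  -- contributes to the derivative at 0.
  have hf : (fun t : 𝕜 => coadExp (t • X) α Y) = fun t => ∑ k ∈ Finset.range (n + 2),
      t ^ k * ((k.factorial : 𝕜)⁻¹ * α (((LieAlgebra.ad 𝕜 g (-X)) ^ k) Y)) := by
    funext t
    have hterm : ∀ k : ℕ, (k.factorial : 𝕜)⁻¹ * α (((LieAlgebra.ad 𝕜 g (-(t • X))) ^ k) Y) =
        t ^ k * ((k.factorial : 𝕜)⁻¹ * α (((LieAlgebra.ad 𝕜 g (-X)) ^ k) Y)) := by
      intro k
      rw [← smul_neg, map_smul, smul_pow, LinearMap.smul_apply, map_smul, smul_eq_mul]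
      ring
    rw [coadExp, tsum_congr hterm, tsum_eq_sum]
    intro k hk
    rw [hn' k (by rw [Finset.mem_range] at hk; omega)]
    simp
  rw [hf]
  have h := HasDerivAt.fun_sum (u := Finset.range (n + 2)) fun k _ =>
    (hasDerivAt_pow k (0 : 𝕜)).mul_const
      ((k.factorial : 𝕜)⁻¹ * α (((LieAlgebra.ad 𝕜 g (-X)) ^ k) Y))
  rw [Finset.sum_range_succ', Finset.sum_range_succ'] at h
  simpa [d_apply, -lie_skew] using h

/-- The tangent space to the coadjoint orbit of `α` is the image of `dα`. -/
theorem orbitTangentSpace_eq_range [LieRing.IsNilpotent g] (α : Module.Dual 𝕜 g) :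
    orbitTangentSpace α = LinearMap.range (d α) := by
  rw [orbitTangentSpace, ← Submodule.span_eq (LinearMap.range (d α))]
  congr 1
  ext β
  constructor
  · rintro ⟨X, hX⟩
    exact ⟨X, LinearMap.ext fun Y => (hasDerivAt_coadExp α X Y).unique (hX Y)⟩
  · rintro ⟨X, rfl⟩
    exact ⟨X, hasDerivAt_coadExp α X⟩

/-- Isotropy sends J into its annihilator, which is a line; a complement of J adds at most one more
dimension. -/
theorem finrank_range_le_two_of_isotropic [FiniteDimensional 𝕜 g] {α : Module.Dual 𝕜 g}
    {J : Submodule 𝕜 g} (hJ : Module.finrank 𝕜 J + 1 = Module.finrank 𝕜 g)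
    (h : ∀ X ∈ J, ∀ Y ∈ J, d α X Y = 0) : Module.finrank 𝕜 (LinearMap.range (d α)) ≤ 2 := by
  obtain ⟨C, hC⟩ := J.exists_isCompl
  have hdC : Module.finrank 𝕜 J + Module.finrank 𝕜 C = Module.finrank 𝕜 g :=
    Submodule.finrank_add_eq_of_isCompl hC
  have hann : Module.finrank 𝕜 J + Module.finrank 𝕜 J.dualAnnihilator = Module.finrank 𝕜 g :=
    Subspace.finrank_add_finrank_dualAnnihilator_eq J
  have h1 : Module.finrank 𝕜 (J.map (d α)) ≤ 1 := by
    have : J.map (d α) ≤ J.dualAnnihilator := by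
      rintro _ ⟨X, hX, rfl⟩
      rw [Submodule.mem_dualAnnihilator]
      exact h X hX
    have : Module.finrank 𝕜 (J.map (d α)) ≤ Module.finrank 𝕜 J.dualAnnihilator :=
      Submodule.finrank_mono this
    omega
  have h2 : Module.finrank 𝕜 (C.map (d α)) ≤ 1 :=
    (Submodule.finrank_map_le _ _).trans (by omega)
  rw [LinearMap.range_eq_map, ← hC.sup_eq_top, Submodule.map_sup]
  exact (Submodule.finrank_add_le_finrank_add_finrank _ _).trans (by omega)

/-- Each [T, X] equals [T, Z] for some Z in I, so X may be replaced by Z once ad T is applied at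
least once. -/
theorem range_ad_pow_eq_map (I : LieIdeal 𝕜 g) {T : g}
    (hT : ∀ X Y : g, ⁅X, Y⁆ ∈ I.toSubmodule.map (LieAlgebra.ad 𝕜 g T)) (k : ℕ) :
    LinearMap.range (LieAlgebra.ad 𝕜 g T ^ (k + 1)) =
      I.toSubmodule.map (LieAlgebra.ad 𝕜 g T ^ (k + 1)) := by
  apply le_antisymm
  · rintro _ ⟨X, rfl⟩
    obtain ⟨Z, hZ, hZX⟩ := hT T X
    refine ⟨Z, hZ, ?_⟩
    rw [pow_succ, Module.End.mul_apply, Module.End.mul_apply, hZX, LieAlgebra.ad_apply]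
  · exact LinearMap.map_le_range

variable (I : LieIdeal 𝕜 g) [IsLieAbelian I]

theorem lie_eq_zero_of_mem_abelian_ideal {X Y : g} (hX : X ∈ I) (hY : Y ∈ I) : ⁅X, Y⁆ = 0 :=
  congrArg Subtype.val (LieModule.IsTrivial.trivial (⟨X, hX⟩ : I) (⟨Y, hY⟩ : I))

/-- Under the orbit condition, bracketing with any vector outside `I` maps `I` onto a subspace
containing all brackets. -/
theorem lie_mem_map_ad [FiniteDimensional 𝕜 g] [LieRing.IsNilpotent g]
    (horbit : ∀ α : Module.Dual 𝕜 g, ¬ IsClosedForm α → orbitDim α = 4)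
    (hcodim : Module.finrank 𝕜 (g ⧸ I.toSubmodule) = 2) {T : g} (hT : T ∉ I) (X Y : g) :
    ⁅X, Y⁆ ∈ I.toSubmodule.map (LieAlgebra.ad 𝕜 g T) := by
  rw [← Subspace.forall_mem_dualAnnihilator_apply_eq_zero_iff]
  intro α hα
  rw [Submodule.mem_dualAnnihilator] at hα
  have hTI : ∀ Z ∈ I, α ⁅T, Z⁆ = 0 := fun Z hZ => hα _ ⟨Z, hZ, rfl⟩
  have hTI' : ∀ Z ∈ I, α ⁅Z, T⁆ = 0 := fun Z hZ => by
    rw [← lie_skew, map_neg, hTI Z hZ, neg_zero]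
  by_contra hne
  have hnc : ¬ IsClosedForm α := fun hc => hne <| by
    have := congrArg (fun f => f X Y) (show d α = 0 from hc)
    simpa [d_apply] using this
  have h4 : Module.finrank 𝕜 (LinearMap.range (d α)) = 4 := by
    rw [← orbitTangentSpace_eq_range]
    exact horbit α hnc
  have hT0 : T ≠ 0 := fun h => hT (h ▸ I.zero_mem)
  have hdisj : I.toSubmodule ⊓ Submodule.span 𝕜 {T} = ⊥ :=
    ((Submodule.disjoint_span_singleton' hT0).mpr hT).eq_bot
  have hdim : Module.finrank 𝕜 ↥(I.toSubmodule ⊔ Submodule.span 𝕜 {T}) =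
      Module.finrank 𝕜 I.toSubmodule + 1 := by
    have h := Submodule.finrank_sup_add_finrank_inf_eq I.toSubmodule (Submodule.span 𝕜 {T})
    rwa [hdisj, finrank_bot, finrank_span_singleton hT0] at h
  have hq : Module.finrank 𝕜 (g ⧸ I.toSubmodule) + Module.finrank 𝕜 I.toSubmodule =
      Module.finrank 𝕜 g := I.toSubmodule.finrank_quotient_add_finrank
  have h2 : Module.finrank 𝕜 (LinearMap.range (d α)) ≤ 2 := finrank_range_le_two_of_isotropic (α := α)
    (J := I.toSubmodule ⊔ Submodule.span 𝕜 {T}) (by omega) (by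
      intro A hA B hB
      obtain ⟨A', hA', a, ha, rfl⟩ := Submodule.mem_sup.mp hA
      obtain ⟨B', hB', b, hb, rfl⟩ := Submodule.mem_sup.mp hB
      obtain ⟨s, rfl⟩ := Submodule.mem_span_singleton.mp ha
      obtain ⟨t, rfl⟩ := Submodule.mem_span_singleton.mp hb
      rw [d_apply]
      simp [lie_eq_zero_of_mem_abelian_ideal I hA' hB', hTI B' hB', hTI' A' hA'])
  omega

theorem map_ad_pow_eq_map_ad_pow (hI : ∀ X Y : g, ⁅X, Y⁆ ∈ I) {S T : g}
    (h : I.toSubmodule.map (LieAlgebra.ad 𝕜 g S) = I.toSubmodule.map (LieAlgebra.ad 𝕜 g T))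
    (k : ℕ) : I.toSubmodule.map (LieAlgebra.ad 𝕜 g S ^ k) =
      I.toSubmodule.map (LieAlgebra.ad 𝕜 g T ^ k) := by
  have hmap : ∀ (X : g) (k : ℕ), I.toSubmodule.map (LieAlgebra.ad 𝕜 g X ^ k) =
      (LinearMap.range (LieModule.toEnd 𝕜 g I X ^ k)).map I.toSubmodule.subtype := by
    intro X k
    rw [← LinearMap.range_comp]
    ext Z
    constructor
    · rintro ⟨Y, hY, rfl⟩
      exact ⟨⟨Y, hY⟩, LieSubmodule.coe_toEnd_pow 𝕜 g g I X ⟨Y, hY⟩ k⟩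
    · rintro ⟨Y, rfl⟩
      exact ⟨Y, Y.2, (LieSubmodule.coe_toEnd_pow 𝕜 g g I X Y k).symm⟩
  -- The commutator is the action of [S, T], an element of I, on the abelian ideal I.
  have hcomm : Commute (LieModule.toEnd 𝕜 g I S) (LieModule.toEnd 𝕜 g I T) := by
    refine LinearMap.ext fun Y => Subtype.ext ?_
    change ⁅S, ⁅T, (Y : g)⁆⁆ = ⁅T, ⁅S, (Y : g)⁆⁆
    rw [leibniz_lie, lie_eq_zero_of_mem_abelian_ideal I (hI S T) Y.2, zero_add]
  have h1 : LinearMap.range (LieModule.toEnd 𝕜 g I S) =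
      LinearMap.range (LieModule.toEnd 𝕜 g I T) := by
    apply Submodule.map_injective_of_injective I.toSubmodule.injective_subtype
    have hS := hmap S 1
    have hT := hmap T 1
    rw [pow_one, pow_one] at hS hT
    rw [← hS, ← hT, h]
  rw [hmap, hmap]
  congr 1
  induction k with
  | zero => simp
  | succ k ih =>
    -- S(S^k I) = S(T^k I) = T^k(S I) = T^k(T I).
    rw [pow_succ', Module.End.mul_eq_comp, LinearMap.range_comp, ih, ← LinearMap.range_comp,
      ← Module.End.mul_eq_comp, (hcomm.pow_right k).eq, Module.End.mul_eq_comp,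
      LinearMap.range_comp, h1, ← LinearMap.range_comp, ← Module.End.mul_eq_comp, ← pow_succ]

/-- The powers of `ad S` and `ad T` have the same images for `S` and `T` outside `I`. -/
theorem range_ad_pow_eq_range_ad_pow (hI : ∀ X Y : g, ⁅X, Y⁆ ∈ I) {S T : g}
    (hS : ∀ X Y : g, ⁅X, Y⁆ ∈ I.toSubmodule.map (LieAlgebra.ad 𝕜 g S))
    (hT : ∀ X Y : g, ⁅X, Y⁆ ∈ I.toSubmodule.map (LieAlgebra.ad 𝕜 g T)) (k : ℕ) :
    LinearMap.range (LieAlgebra.ad 𝕜 g S ^ k) = LinearMap.range (LieAlgebra.ad 𝕜 g T ^ k) := by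
  cases k with
  | zero => simp
  | succ k =>
    rw [range_ad_pow_eq_map I hS, range_ad_pow_eq_map I hT]
    refine map_ad_pow_eq_map_ad_pow I hI (le_antisymm ?_ ?_) _
    · rintro _ ⟨X, -, rfl⟩
      exact hT S X
    · rintro _ ⟨X, -, rfl⟩
      exact hS T X

/-- The Jordan sequence of `ad T` for `T` outside `I` dominates that of every vector. -/
theorem isJordanSequence_le [FiniteDimensional 𝕜 g] (hI : ∀ X Y : g, ⁅X, Y⁆ ∈ I)
    (hW : ∀ T : g, T ∉ I → ∀ X Y : g, ⁅X, Y⁆ ∈ I.toSubmodule.map (LieAlgebra.ad 𝕜 g T))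
    {T X : g} (hT : T ∉ I) {c s : List ℕ} (hc : IsJordanSequence (LieAlgebra.ad 𝕜 g T) c)
    (hs : IsJordanSequence (LieAlgebra.ad 𝕜 g X) s) : s ≤ c := by
  by_cases hX : X ∈ I
  · have h2 : LieAlgebra.ad 𝕜 g X ^ 2 = 0 := by
      refine LinearMap.ext fun Y => ?_
      rw [pow_two, Module.End.mul_apply, LieAlgebra.ad_apply, LieAlgebra.ad_apply]
      exact lie_eq_zero_of_mem_abelian_ideal I hX (hI X Y)
    have hs2 : powRank s 2 = 0 := by
      rw [← hs.finrank_range_pow, h2, LinearMap.range_zero, finrank_bot]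
    refine le_of_powRank_one_le hc.1 hc.2.1 hs.2.1 (powRank_eq_zero_iff.mp hs2) ?_ ?_
    · rw [← hs.finrank_range_pow, ← hc.finrank_range_pow, pow_zero, pow_zero]
    · rw [← hs.finrank_range_pow, ← hc.finrank_range_pow, pow_one, pow_one]
      apply Submodule.finrank_mono
      rintro _ ⟨Y, rfl⟩
      exact LinearMap.map_le_range (hW T hT X Y)
  · refine (eq_of_powRank_eq hs.1 hc.1 hs.2.1 hc.2.1 fun k => ?_).le
    rw [← hs.finrank_range_pow, ← hc.finrank_range_pow,
      range_ad_pow_eq_range_ad_pow I hI (hW X hX) (hW T hT)]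

end LieAlgebra

end Coadjoint

theorem mainTheorem10 {𝕜 : Type*} [RCLike 𝕜] {g : Type*} [LieRing g] [LieAlgebra 𝕜 g]
    [FiniteDimensional 𝕜 g] [LieRing.IsNilpotent g]
    (horbit : ∀ α : Module.Dual 𝕜 g, ¬ Coadjoint.IsClosedForm α → Coadjoint.orbitDim α = 4)
    (m : Submodule 𝕜 g) (I : LieIdeal 𝕜 g) [IsLieAbelian I]
    (hmI : IsCompl m I.toSubmodule)
    (hcodim : Module.finrank 𝕜 (g ⧸ I.toSubmodule) = 2) :
    ∃ T : Module.Basis (Fin 2) 𝕜 m,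
      Coadjoint.IsCharacteristicVector 𝕜 (T 0 : g) ∧
      Coadjoint.IsCharacteristicVector 𝕜 (T 1 : g) ∧
      (∃ c : List ℕ, Coadjoint.IsJordanSequence (LieAlgebra.ad 𝕜 g (T 0 : g)) c ∧
        Coadjoint.IsJordanSequence (LieAlgebra.ad 𝕜 g (T 1 : g)) c) ∧
      LinearMap.range (LieAlgebra.ad 𝕜 g (T 0 : g)) =
        LinearMap.range (LieAlgebra.ad 𝕜 g (T 1 : g)) := by
  have hW : ∀ T : g, T ∉ I → ∀ X Y : g, ⁅X, Y⁆ ∈ I.toSubmodule.map (LieAlgebra.ad 𝕜 g T) :=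
    fun T hT => Coadjoint.lie_mem_map_ad I horbit hcodim hT
  have hm : Module.finrank 𝕜 m = 2 := by
    rw [← hcodim, (Submodule.quotientEquivOfIsCompl _ _ hmI.symm).finrank_eq]
  let T : Module.Basis (Fin 2) 𝕜 m := Module.finBasisOfFinrankEq 𝕜 m hm
  have hT : ∀ i, (T i : g) ∉ I := fun i hi =>
    T.ne_zero i (Subtype.ext (Submodule.disjoint_def.mp hmI.disjoint _ (T i).2 hi))
  have hI : ∀ X Y : g, ⁅X, Y⁆ ∈ I := by
    intro X Y
    obtain ⟨Z, hZ, hZX⟩ := hW _ (hT 0) X Y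
    rw [← hZX]
    exact I.lie_mem hZ
  -- The maximum defining c(g) runs only over vectors outside [g, g], which is contained in I.
  have hder : ∀ i, (T i : g) ∉ ⁅(⊤ : LieIdeal 𝕜 g), (⊤ : LieIdeal 𝕜 g)⁆ := fun i hi =>
    hT i ((LieSubmodule.lie_le_iff _ _ _).mpr (fun X _ Y _ => hI X Y) hi)
  have hJ : ∀ i, ∃ c, Coadjoint.IsJordanSequence (LieAlgebra.ad 𝕜 g (T i : g)) c := fun i =>
    Coadjoint.exists_isJordanSequence (LieModule.isNilpotent_toEnd_of_isNilpotent 𝕜 g g _)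
  have hchar : ∀ i c, Coadjoint.IsJordanSequence (LieAlgebra.ad 𝕜 g (T i : g)) c →
      Coadjoint.IsCharacteristicSequence 𝕜 g c := fun i c hc =>
    ⟨⟨T i, hder i, hc⟩, fun s ⟨_, _, hs⟩ => Coadjoint.isJordanSequence_le I hI hW (hT i) hc hs⟩
  obtain ⟨c, hc⟩ := hJ 0
  obtain ⟨c', hc'⟩ := hJ 1
  obtain rfl : c = c' := le_antisymm
    (Coadjoint.isJordanSequence_le I hI hW (hT 1) hc' hc)
    (Coadjoint.isJordanSequence_le I hI hW (hT 0) hc hc')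
  refine ⟨T, ⟨c, hchar 0 c hc, hc⟩, ⟨c, hchar 1 c hc', hc'⟩, ⟨c, hc, hc'⟩, ?_⟩
  simpa using Coadjoint.range_ad_pow_eq_range_ad_pow I hI (hW _ (hT 0)) (hW _ (hT 1)) 1
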